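/- Let $J>3$ be an integer, $k:=\tfrac12(J-1)$, and let $G_0$ be an arbitrary probability distribution on $\mathbb{R}\times(0,\infty)$. Suppose that $(\mu,\sigma)\sim G_0$ and $$Y_j=\mu+\sigma\,\epsilon_j,\qquad j=1,\dots,J,$$ where, conditionally on $(\mu,\sigma)$, the $\epsilon_j$ are i.i.d. $N(0,1)$. Let $\bar Y=\frac1J\sum_j Y_j$ and $S^2=\frac1{J-1}\sum_j(Y_j-\bar Y)^2$ be the sufficient statistics, with values denoted $(y,s^2)$. Let $$p(y,v\mid\mu,\sigma)=\phi_{\mu,\sigma^2/J}(y)\,\gamma_{k,\sigma^2/k}(v),\qquad f_{G_0}(y,v)=\int p(y,v\mid\mu,\sigma)\,dG_0(\mu,\sigma),$$ where $\phi_{m,w}$ is the density of $N(m,w)$ and $\gamma_{k,\theta}$ that of the gamma distribution with shape $k$ and scale $\theta$. Let $\mathbb{E}_{G_0}[\,\cdot\mid y,s]$ denote the mean under the posterior $p(y,s^2\mid\mu,\sigma)\,G_0(d\mu,d\sigma)/f_{G_0}(y,s^2)$, and write $f_{G_0}(y\mid s)=f_{G_0}(y,s^2)/\int f_{G_0}(x,s^2)\,dx$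 and $f_{G_0}(v\mid y)=f_{G_0}(y,v)/\int f_{G_0}(y,t)\,dt$. Then $f_{G_0}$ is the (mixture) density of $(\bar Y,S^2)$, this posterior is a version of the conditional distribution of $(\mu,\sigma)$ given $(\bar Y,S^2)$, and for all $y\in\mathbb{R}$ and $s>0$ the posterior means, derivatives and integrals below exist and are finite, and $$(i)\quad \mathbb{E}_{G_0}[\mu\mid y,s]=y+\frac{\mathbb{E}_{G_0}[\sigma^2\mid y,s]}{J}\cdot\frac{\partial}{\partial y}\log f_{G_0}(y\mid s)+\frac1J\frac{\partial}{\partial y}\mathbb{E}_{G_0}[\sigma^2\mid y,s],$$ $$(ii)\quad \mathbb{E}_{G_0}[\sigma^2\mid y,s]=k\int_{s^2}^\infty\Big[\frac{s^2}{t}\Big]^{k-1}\frac{f_{G_0}(y,t)}{f_{G_0}(y,s^2)}\,dt,$$ $$(iii)\quad \mathbb{E}_{G_0}[\sigma\mid y,s]=\frac{k}{\Gamma(1/2)}\int_{s^2}^\infty\frac{1}{\sqrt{k(t-s^2)}}\Big[\frac{s^2}{t}\Big]^{k-1}\frac{f_{G_0}(y,t)}{f_{G_0}(y,s^2)}\,dt.$$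 In (ii) and (iii) the ratio $f_{G_0}(y,t)/f_{G_0}(y,s^2)$ may be replaced by $f_{G_0}(t\mid y)/f_{G_0}(s^2\mid y)$ whenever $\int f_{G_0}(y,t)\,dt<\infty$, which holds for almost every $y$. -/

import Mathlib

open MeasureTheory ProbabilityTheory Set

noncomputable section

/-- The sample mean `(1/J) ∑ⱼ xⱼ`. -/
def sampleMean {J : ℕ} (x : Fin J → ℝ) : ℝ := (∑ j, x j) / J

/-- The (unbiased) sample variance `(1/(J-1)) ∑ⱼ (xⱼ - x̄)²`. -/
def sampleVar {J : ℕ} (x : Fin J → ℝ) : ℝ :=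
  (∑ j, (x j - sampleMean x) ^ 2) / ((J : ℝ) - 1)

/-- The Gaussian model with unknown mean and unknown variance: `(μ, σ) ∼ G`, and
`Yⱼ = μ + σ εⱼ` for `j = 1, …, J`, where, conditionally on `(μ, σ)`, the `εⱼ` are i.i.d. `N(0, 1)`. -/
structure IsHeteroskedasticModel {Ω : Type*} [MeasurableSpace Ω] (P : Measure Ω) {J : ℕ}
    (G : Measure (ℝ × ℝ)) (mu sigma : Ω → ℝ) (eps Y : Fin J → Ω → ℝ) : Prop where
  params_law : HasLaw (fun ω => (mu ω, sigma ω)) G P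
  noise_law : HasCondDistrib (fun ω j => eps j ω) (fun ω => (mu ω, sigma ω))
    (Kernel.const (ℝ × ℝ) (Measure.pi fun _ : Fin J => gaussianReal 0 1)) P
  obs_eq : ∀ j, ∀ᵐ ω ∂P, Y j ω = mu ω + sigma ω * eps j ω

/-- `k = (J - 1) / 2`. -/
def shapeK (J : ℕ) : ℝ := ((J : ℝ) - 1) / 2

/-- The sampling density `p(y, v ∣ μ, σ)` of (sample mean, sample variance): the product of the
`N(μ, σ²/J)` density at `y` and the gamma density with shape `k` and scale `σ²/k`
(that is, rate `k/σ²`) at `v`. -/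
def samplingDensity (J : ℕ) (mu sigma y v : ℝ) : ℝ :=
  gaussianPDFReal mu (sigma ^ 2 / J).toNNReal y *
    gammaPDFReal (shapeK J) (shapeK J / sigma ^ 2) v

/-- The mixture density `f_G(y, v)`. -/
def mixtureDensity (J : ℕ) (G : Measure (ℝ × ℝ)) (y v : ℝ) : ℝ :=
  ∫ p, samplingDensity J p.1 p.2 y v ∂G

/-- The conditional density `f_G(y ∣ v)` of the sample mean given the sample variance. -/
def condDensityMean (J : ℕ) (G : Measure (ℝ × ℝ)) (y v : ℝ) : ℝ :=
  mixtureDensity J G y v / ∫ x, mixtureDensity J G x v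

/-- The conditional density `f_G(v ∣ y)` of the sample variance given the sample mean. -/
def condDensityVar (J : ℕ) (G : Measure (ℝ × ℝ)) (v y : ℝ) : ℝ :=
  mixtureDensity J G y v / ∫ t, mixtureDensity J G y t

/-- The posterior distribution of `(μ, σ)` given (sample mean, sample variance) `= (y, v)`,
by Bayes' rule: `p(y, v ∣ μ, σ) G(dμ, dσ) / f_G(y, v)`. -/
def posteriorLaw (J : ℕ) (G : Measure (ℝ × ℝ)) (y v : ℝ) : Measure (ℝ × ℝ) :=
  (ENNReal.ofReal (mixtureDensity J G y v))⁻¹ •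
    G.withDensity fun p => ENNReal.ofReal (samplingDensity J p.1 p.2 y v)

/-- The posterior mean `E_G[h(μ, σ) ∣ y, v]`. -/
def posteriorMean (J : ℕ) (G : Measure (ℝ × ℝ)) (h : ℝ × ℝ → ℝ) (y v : ℝ) : ℝ :=
  ∫ p, h p ∂(posteriorLaw J G y v)

end

/-! Given $(\mu,\sigma)$, a rotation sending the normalised constant vector to a coordinate axis
separates the sample mean from the residuals. Hence the statistics are independent, Gaussian and
gamma, with joint density $p$ (`map_sampleMean_sampleVar_pi_gaussianReal`). Mixing over $G$ gives
$f_G$, and disintegration gives the posterior (`compProd_posteriorKernel`).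

Each formula averages over $G$ an identity for $p$ at fixed $(\mu,\sigma)$. For (i), the Gaussian
score is $-J(y-\mu)/\sigma^2$, so $\partial_y(\sigma^2 p)=J(\mu-y)p$; the quotient rule for
$\mathbb{E}[\sigma^2\mid y,s]$ then contains $\mathbb{E}[\mu\mid y,s]$, and solving for it gives
(i). For (ii), multiplying the gamma density by $t^{1-k}$ leaves a pure exponential of rate
$k/\sigma^2$, whose tail integral brings out $\sigma^2/k$. For (iii), the extra weight
$(t-v)^{-1/2}$ turns that tail into a $\Gamma(1/2)$ integral, which brings out $\sigma$.

No moments of $G$ are needed: $p$ carries the factor $\sigma^{-(2k+1)}e^{-kv/\sigma^2}$ and Gaussian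
decay in $(y-\mu)/\sigma$, so moderate weights times $p$ are bounded uniformly
(`exists_rpow_mul_samplingDensity_le`). This yields integrability and domination under the
derivative; Tonelli exchanges the tail integrals with the mixture. -/

/-! ### Chi-square and gamma laws via characteristic functions. -/

lemma integral_gaussianReal_cexp_mul_sq (c t : ℝ) :
    ∫ w, Complex.exp (t * (c * w ^ 2 : ℝ) * Complex.I) ∂(gaussianReal 0 1) =
      (1 - 2 * c * t * Complex.I) ^ (-(1 / 2) : ℂ) := by
  rw [integral_gaussianReal_eq_integral_smul one_ne_zero]
  have hb : 0 < (1 / 2 - c * t * Complex.I : ℂ).re := by simp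
  have h1 : ∀ w : ℝ, gaussianPDFReal 0 1 w • Complex.exp (t * (c * w ^ 2 : ℝ) * Complex.I) =
      (((√(2 * Real.pi))⁻¹ : ℝ) : ℂ) * Complex.exp (-(1 / 2 - c * t * Complex.I) * w ^ 2) := by
    intro w
    rw [gaussianPDFReal, Complex.real_smul]
    push_cast
    rw [mul_assoc, ← Complex.exp_add]
    simp only [mul_one, sub_zero]
    ring_nf
  simp_rw [h1]
  rw [integral_const_mul, integral_gaussian_complex hb]
  have hre : (1 - 2 * c * t * Complex.I : ℂ).re = 1 := by simp
  have hne : (1 - 2 * c * t * Complex.I : ℂ) ≠ 0 := fun h => by rw [h] at hre; simp at hre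
  -- Real part 1 keeps the base off the branch cut, so the logarithm of its inverse is minus its
  -- logarithm.
  have harg : (1 - 2 * c * t * Complex.I : ℂ).arg ≠ Real.pi := by
    intro h
    have := (Complex.arg_eq_pi_iff.1 h).1
    rw [hre] at this
    linarith
  have h2 : (Real.pi / (1 / 2 - c * t * Complex.I) : ℂ) =
      ((2 * Real.pi : ℝ) : ℂ) * (1 - 2 * c * t * Complex.I)⁻¹ := by
    have h' : (1 / 2 - c * t * Complex.I : ℂ) = (1 - 2 * c * t * Complex.I) / 2 := by ring
    rw [h']
    push_cast
    field_simp
  have hpi : (0 : ℝ) < 2 * Real.pi := by positivity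
  rw [h2, Complex.cpow_def_of_ne_zero (mul_ne_zero (by exact_mod_cast hpi.ne') (inv_ne_zero hne)),
    Complex.log_ofReal_mul hpi (inv_ne_zero hne), add_mul, Complex.exp_add,
    Complex.log_inv _ harg, Complex.cpow_def_of_ne_zero hne]
  have h3 : Complex.exp ((Real.log (2 * Real.pi) : ℝ) * (1 / 2 : ℂ)) =
      ((√(2 * Real.pi) : ℝ) : ℂ) := by
    rw [Real.sqrt_eq_rpow, Real.rpow_def_of_pos hpi]
    push_cast
    rfl
  rw [h3, ← mul_assoc, ← Complex.ofReal_mul, inv_mul_cancel₀ (Real.sqrt_pos.2 hpi).ne',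
    Complex.ofReal_one, one_mul]
  ring_nf

/-- Exponential tilting turns a gamma density of rate `r` into a multiple of the one of rate `r -
t`. -/
lemma lintegral_exp_mul_gammaMeasure {a r t : ℝ} (ha : 0 < a) (hr : 0 < r) (ht : t < r) :
    ∫⁻ x, ENNReal.ofReal (Real.exp (t * x)) ∂(gammaMeasure a r) =
      ENNReal.ofReal ((r / (r - t)) ^ a) := by
  have hrt : 0 < r - t := sub_pos.2 ht
  rw [gammaMeasure, lintegral_withDensity_eq_lintegral_mul _
    (f := gammaPDF a r) (measurable_gammaPDFReal a r).ennreal_ofReal (by fun_prop)]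
  have h : ∀ x, (gammaPDF a r * fun x => ENNReal.ofReal (Real.exp (t * x))) x =
      ENNReal.ofReal ((r / (r - t)) ^ a) * gammaPDF a (r - t) x := by
    intro x
    simp only [Pi.mul_apply, gammaPDF]
    rw [← ENNReal.ofReal_mul (gammaPDFReal_nonneg ha hr x), ← ENNReal.ofReal_mul (by positivity)]
    congr 1
    unfold gammaPDFReal
    split_ifs
    · have e : Real.exp (-((r - t) * x)) = Real.exp (-(r * x)) * Real.exp (t * x) := by
        rw [← Real.exp_add]; ring_nf
      rw [e, Real.div_rpow hr.le hrt.le]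
      have := (Real.rpow_pos_of_pos hrt a).ne'
      field_simp
    · simp
  simp_rw [h]
  rw [lintegral_const_mul _ (f := gammaPDF a (r - t))
    (measurable_gammaPDFReal a _).ennreal_ofReal,
    lintegral_gammaPDF_eq_one ha hrt, mul_one]

lemma integrable_exp_mul_gammaMeasure {a r t : ℝ} (ha : 0 < a) (hr : 0 < r) (ht : t < r) :
    Integrable (fun x => Real.exp (t * x)) (gammaMeasure a r) := by
  refine ⟨by fun_prop, ?_⟩
  rw [hasFiniteIntegral_iff_ofReal (ae_of_all _ fun x => (Real.exp_pos _).le),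
    lintegral_exp_mul_gammaMeasure ha hr ht]
  exact ENNReal.ofReal_lt_top

lemma mgf_id_gammaMeasure {a r t : ℝ} (ha : 0 < a) (hr : 0 < r) (ht : t < r) :
    mgf id (gammaMeasure a r) t = (1 - t / r) ^ (-a) := by
  have hrt : 0 < r - t := sub_pos.2 ht
  have h1 : 1 - t / r = (r - t) / r := by field_simp
  rw [mgf, integral_eq_lintegral_of_nonneg_ae (ae_of_all _ fun x => (Real.exp_pos _).le)
    (by fun_prop)]
  simp only [id_eq]
  rw [lintegral_exp_mul_gammaMeasure ha hr ht, ENNReal.toReal_ofReal (by positivity), h1,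
    Real.rpow_neg (by positivity), ← Real.inv_rpow (by positivity), inv_div]

/-- Analytic continuation: both sides are analytic on the half-plane `z.re < r` and agree at real
points near 0, which accumulate at 0. -/
lemma complexMGF_id_gammaMeasure {a r : ℝ} (ha : 0 < a) (hr : 0 < r) {z : ℂ} (hz : z.re < r) :
    complexMGF id (gammaMeasure a r) z = (1 - z / r) ^ (-a : ℂ) := by
  have hsub : Iio r ⊆ interior (integrableExpSet id (gammaMeasure a r)) :=
    interior_maximal (fun t ht => integrable_exp_mul_gammaMeasure ha hr ht) isOpen_Iio
  have hX : AnalyticOnNhd ℂ (complexMGF id (gammaMeasure a r)) {z | z.re < r} :=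
    analyticOnNhd_complexMGF.mono fun z hz => hsub hz
  have hY : AnalyticOnNhd ℂ (fun z : ℂ => (1 - z / r) ^ (-a : ℂ)) {z | z.re < r} := by
    intro z hz
    have hz' : z.re < r := hz
    refine AnalyticAt.cpow (by fun_prop) (by fun_prop) (Or.inl ?_)
    rw [Complex.sub_re, Complex.one_re, Complex.div_ofReal_re, sub_pos, div_lt_one hr]
    exact hz'
  refine AnalyticOnNhd.eqOn_of_preconnected_of_frequently_eq hX hY
    ((convex_Iio r).linear_preimage Complex.reLm).isPreconnected (z₀ := 0) (by simpa using hr) ?_ hz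
  have hreal : ∀ᶠ x : ℝ in nhds 0, complexMGF id (gammaMeasure a r) x =
      (1 - (x : ℂ) / r) ^ (-a : ℂ) := by
    filter_upwards [Iio_mem_nhds hr] with x hx
    have hx' : 0 < 1 - x / r := by rw [sub_pos, div_lt_one hr]; exact hx
    rw [complexMGF_ofReal, mgf_id_gammaMeasure ha hr hx, Complex.ofReal_cpow hx'.le]
    push_cast
    rfl
  have hfreq : ∃ᶠ x : ℝ in nhdsWithin 0 {0}ᶜ, complexMGF id (gammaMeasure a r) x =
      (1 - (x : ℂ) / r) ^ (-a : ℂ) := (hreal.filter_mono nhdsWithin_le_nhds).frequently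
  have hten : Filter.Tendsto (fun x : ℝ => (x : ℂ)) (nhdsWithin 0 {0}ᶜ) (nhdsWithin 0 {0}ᶜ) := by
    refine tendsto_nhdsWithin_iff.2 ⟨?_, ?_⟩
    · exact (Complex.continuous_ofReal.tendsto' 0 0 (by simp)).mono_left nhdsWithin_le_nhds
    · filter_upwards [self_mem_nhdsWithin] with x hx
      simpa using hx
  exact hten.frequently hfreq

/-- A scaled chi-square distribution is a gamma distribution. -/
lemma map_sum_sq_pi_gaussianReal {n : ℕ} (hn : 0 < n) {c : ℝ} (hc : 0 < c) :
    (Measure.pi fun _ : Fin n => gaussianReal 0 1).map (fun w => c * ∑ i, w i ^ 2) =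
      gammaMeasure (n / 2) (1 / (2 * c)) := by
  have ha : (0 : ℝ) < n / 2 := by positivity
  have hr : (0 : ℝ) < 1 / (2 * c) := by positivity
  have := isProbabilityMeasure_gammaMeasure ha hr
  have hm : Measurable fun w : Fin n → ℝ => c * ∑ i, w i ^ 2 := by fun_prop
  have := Measure.isProbabilityMeasure_map (μ := Measure.pi fun _ : Fin n => gaussianReal 0 1)
    hm.aemeasurable
  refine Measure.ext_of_charFun ?_
  ext t
  rw [← complexMGF_id_mul_I (μ := gammaMeasure _ _),
    complexMGF_id_gammaMeasure ha hr (by simpa using hc), charFun_apply_real,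
    integral_map hm.aemeasurable (by fun_prop)]
  have h : ∀ w : Fin n → ℝ, Complex.exp (t * (c * ∑ i, w i ^ 2 : ℝ) * Complex.I) =
      ∏ i, Complex.exp (t * (c * w i ^ 2 : ℝ) * Complex.I) := by
    intro w
    rw [← Complex.exp_sum]
    push_cast
    simp_rw [Finset.mul_sum, Finset.sum_mul]
  simp_rw [h]
  -- Independence makes the characteristic function an `n`-th power; a natural exponent raises no
  -- branch question.
  rw [integral_fintype_prod_eq_pow (fun x : ℝ => Complex.exp (t * (c * x ^ 2 : ℝ) * Complex.I)),
    integral_gaussianReal_cexp_mul_sq, Fintype.card_fin, ← Complex.cpow_nat_mul]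
  congr 1
  · push_cast
    field_simp
  · push_cast
    ring

/-! ### Sample mean and variance of a Gaussian sample. -/

@[fun_prop]
lemma measurable_sampleMean {J : ℕ} : Measurable (sampleMean : (Fin J → ℝ) → ℝ) := by
  unfold sampleMean
  fun_prop

@[fun_prop]
lemma measurable_sampleVar {J : ℕ} : Measurable (sampleVar : (Fin J → ℝ) → ℝ) := by
  unfold sampleVar
  fun_prop

lemma sampleMean_affine {J : ℕ} (hJ : J ≠ 0) (m s : ℝ) (x : Fin J → ℝ) :
    sampleMean (fun j => m + s * x j) = m + s * sampleMean x := by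
  have : (J : ℝ) ≠ 0 := by exact_mod_cast hJ
  simp only [sampleMean, Finset.sum_add_distrib, Finset.sum_const, Finset.card_univ,
    Fintype.card_fin, nsmul_eq_mul, ← Finset.mul_sum]
  field_simp

lemma sampleVar_affine {J : ℕ} (hJ : J ≠ 0) (m s : ℝ) (x : Fin J → ℝ) :
    sampleVar (fun j => m + s * x j) = s ^ 2 * sampleVar x := by
  simp only [sampleVar, sampleMean_affine hJ]
  rw [← mul_div_assoc, Finset.mul_sum]
  congr 1
  refine Finset.sum_congr rfl fun j _ => ?_
  ring

lemma sum_sub_sampleMean_sq {J : ℕ} (hJ : J ≠ 0) (x : Fin J → ℝ) :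
    ∑ j, (x j - sampleMean x) ^ 2 = ∑ j, x j ^ 2 - J * sampleMean x ^ 2 := by
  have hJ' : (J : ℝ) ≠ 0 := by exact_mod_cast hJ
  have h : ∑ j, x j = J * sampleMean x := by
    unfold sampleMean
    field_simp
  simp only [sub_sq, Finset.sum_add_distrib, Finset.sum_sub_distrib, Finset.sum_const,
    Finset.card_univ, Fintype.card_fin, nsmul_eq_mul, ← Finset.sum_mul, ← Finset.mul_sum, h]
  ring

/-- A rotation whose zeroth coordinate is proportional to the sample mean. -/
lemma exists_linearIsometryEquiv_sampleMean (n : ℕ) :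
    ∃ U : EuclideanSpace ℝ (Fin (n + 1)) ≃ₗᵢ[ℝ] EuclideanSpace ℝ (Fin (n + 1)),
      ∀ x, U x 0 = √(n + 1) * sampleMean x.ofLp := by
  have hn : (0 : ℝ) < n + 1 := by positivity
  set u : EuclideanSpace ℝ (Fin (n + 1)) := WithLp.toLp 2 fun _ => (√(n + 1))⁻¹ with hu
  have hnorm : ‖u‖ = 1 := by
    rw [EuclideanSpace.norm_eq]
    simp only [hu, Real.norm_eq_abs, sq_abs, inv_pow, Real.sq_sqrt hn.le, Finset.sum_const,
      Finset.card_univ, Fintype.card_fin, nsmul_eq_mul]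
    push_cast
    rw [mul_inv_cancel₀ hn.ne', Real.sqrt_one]
  obtain ⟨b, hb⟩ := Orthonormal.exists_orthonormalBasis_extension_of_card_eq (𝕜 := ℝ)
    (ι := Fin (n + 1)) (E := EuclideanSpace ℝ (Fin (n + 1))) (by simp) (v := fun _ => u)
    (s := {0}) (by
      refine ⟨fun i => by simpa using hnorm, fun i j hij => ?_⟩
      exact absurd (Subsingleton.elim i j) hij)
  refine ⟨b.repr, fun x => ?_⟩
  rw [b.repr_apply_apply, hb 0 rfl, PiLp.inner_apply]
  simp only [hu, RCLike.inner_apply, conj_trivial, sampleMean, ← Finset.sum_mul]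
  push_cast
  have hs : √((n : ℝ) + 1) ≠ 0 := (Real.sqrt_pos.2 hn).ne'
  have hs2 : √((n : ℝ) + 1) * √((n : ℝ) + 1) = n + 1 := Real.mul_self_sqrt hn.le
  field_simp
  rw [sq, hs2]

/-- The sample mean and sample variance of a Gaussian sample are independent, with a Gaussian and
a gamma distribution. -/
lemma map_sampleMean_sampleVar_pi_gaussianReal {J : ℕ} (hJ : 1 < J) (m : ℝ) {s : ℝ} (hs : 0 < s) :
    (Measure.pi fun _ : Fin J => gaussianReal 0 1).map
        (fun e => (m + s * sampleMean e, s ^ 2 * sampleVar e)) =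
      (gaussianReal m (s ^ 2 / J).toNNReal).prod
        (gammaMeasure (shapeK J) (shapeK J / s ^ 2)) := by
  obtain ⟨n, rfl⟩ : ∃ n, J = n + 1 := ⟨J - 1, by omega⟩
  have hn : 0 < n := by omega
  have hn' : (0 : ℝ) < n := by exact_mod_cast hn
  have hn1 : (0 : ℝ) < n + 1 := by positivity
  obtain ⟨U, hU⟩ := exists_linearIsometryEquiv_sampleMean n
  set c : ℝ := s ^ 2 / n with hc
  set d : ℝ := s / √(n + 1) with hd
  let Φ : EuclideanSpace ℝ (Fin (n + 1)) → ℝ × ℝ := fun y =>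
    (m + d * y 0, c * ∑ i : Fin n, y i.succ ^ 2)
  have hΦ : Measurable Φ := by fun_prop
  have h1 : (fun e : Fin (n + 1) → ℝ => (m + s * sampleMean e, s ^ 2 * sampleVar e)) =
      fun e => Φ (U (WithLp.toLp 2 e)) := by
    ext1 e
    have hsq : √((n : ℝ) + 1) ≠ 0 := (Real.sqrt_pos.2 hn1).ne'
    have h0 := hU (WithLp.toLp 2 e)
    -- Since `U` is an isometry, the squares of the coordinates other than 0 sum to $\sum_i
    -- e_i^2-(n+1)\bar e^2$, which is `n * sampleVar e`.
    have hnm : ∑ i, U (WithLp.toLp 2 e) i ^ 2 = ∑ i, e i ^ 2 := by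
      have := U.norm_map (WithLp.toLp 2 e)
      rw [← sq_eq_sq₀ (norm_nonneg _) (norm_nonneg _), EuclideanSpace.real_norm_sq_eq,
        EuclideanSpace.real_norm_sq_eq] at this
      exact this
    rw [Fin.sum_univ_succ, h0, mul_pow, Real.sq_sqrt hn1.le] at hnm
    refine Prod.ext ?_ ?_
    · simp only [Φ, h0, hd]
      field_simp
    · have h2 := sum_sub_sampleMean_sq (Nat.succ_ne_zero n) e
      simp only [Φ, sampleVar, hc]
      push_cast at h2 ⊢
      rw [h2, ← hnm]
      have : (n : ℝ) + 1 - 1 = n := by ring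
      rw [this]
      field_simp
      ring
  have hU_meas : Measurable U := U.continuous.measurable
  -- The standard Gaussian law is rotation invariant, so `U` can be dropped.
  have h2 : (Measure.pi fun _ : Fin (n + 1) => gaussianReal 0 1).map
        (fun e => Φ (U (WithLp.toLp 2 e))) =
      (Measure.pi fun _ : Fin (n + 1) => gaussianReal 0 1).map
        (fun e => Φ (WithLp.toLp 2 e)) := by
    calc _ = (((Measure.pi fun _ : Fin (n + 1) => gaussianReal 0 1).map
          (WithLp.toLp 2)).map U).map Φ := by
          rw [Measure.map_map hΦ hU_meas, Measure.map_map (hΦ.comp hU_meas) (by fun_prop)]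
          rfl
      _ = ((Measure.pi fun _ : Fin (n + 1) => gaussianReal 0 1).map
          (WithLp.toLp 2)).map Φ := by rw [map_pi_eq_stdGaussian, stdGaussian_map]
      _ = _ := by
          rw [Measure.map_map hΦ (by fun_prop)]
          rfl
  have h3 : (fun e : Fin (n + 1) → ℝ => Φ (WithLp.toLp 2 e)) =
      Prod.map (fun x => m + d * x) (fun w : Fin n → ℝ => c * ∑ i, w i ^ 2) ∘
        MeasurableEquiv.piFinSuccAbove (fun _ => ℝ) 0 := by
    ext1 e
    simp [Φ, MeasurableEquiv.piFinSuccAbove_apply, Fin.tail]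
  have hpos : 0 < c := by positivity
  rw [h1, h2, h3, ← Measure.map_map (by fun_prop) (MeasurableEquiv.measurable _),
    (measurePreserving_piFinSuccAbove (fun _ : Fin (n + 1) => gaussianReal 0 1) 0).map_eq,
    ← Measure.map_prod_map _ _ (by fun_prop) (by fun_prop), map_sum_sq_pi_gaussianReal hn hpos]
  have h4 : (gaussianReal 0 1).map (fun x => m + d * x) =
      gaussianReal m (s ^ 2 / ((n + 1 : ℕ) : ℝ)).toNNReal := by
    have : (fun x : ℝ => m + d * x) = (fun x => m + x) ∘ fun x => d * x := rfl
    rw [this, ← Measure.map_map (by fun_prop) (by fun_prop), gaussianReal_map_const_mul,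
      gaussianReal_map_const_add]
    congr 1
    · ring
    · ext
      rw [Real.coe_toNNReal _ (by positivity)]
      simp only [mul_one, NNReal.coe_mk, hd, div_pow, Real.sq_sqrt hn1.le]
      push_cast
      rfl
  rw [h4]
  congr 2
  · simp [shapeK]
  · simp only [shapeK, hc]
    push_cast
    field_simp
    ring

/-! ### The sampling density: sign, measurability, support. -/

lemma samplingDensity_nonneg {J : ℕ} (hJ : 1 < J) {p : ℝ × ℝ} (hp : 0 < p.2) (y v : ℝ) :
    0 ≤ samplingDensity J p.1 p.2 y v := by
  have : (1 : ℝ) < J := by exact_mod_cast hJ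
  have hk : 0 < shapeK J := by unfold shapeK; linarith
  exact mul_nonneg (gaussianPDFReal_nonneg _ _ _) (gammaPDFReal_nonneg hk (by positivity) _)

lemma map_sampleMean_sampleVar_eq_withDensity {J : ℕ} (hJ : 1 < J) (m : ℝ) {s : ℝ} (hs : 0 < s) :
    (Measure.pi fun _ : Fin J => gaussianReal 0 1).map
        (fun e => (m + s * sampleMean e, s ^ 2 * sampleVar e)) =
      (volume : Measure (ℝ × ℝ)).withDensity
        fun q => ENNReal.ofReal (samplingDensity J m s q.1 q.2) := by
  have hJ0 : (0 : ℝ) < J := by positivity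
  have hv : (s ^ 2 / J).toNNReal ≠ 0 := by
    rw [ne_eq, Real.toNNReal_eq_zero, not_le]
    positivity
  rw [map_sampleMean_sampleVar_pi_gaussianReal hJ m hs, gaussianReal_of_var_ne_zero _ hv,
    gammaMeasure, prod_withDensity (measurable_gaussianPDF _ _)
      (g := gammaPDF _ _) (measurable_gammaPDFReal _ _).ennreal_ofReal, ← Measure.volume_eq_prod]
  congr 1
  ext1 q
  rw [samplingDensity, ENNReal.ofReal_mul (gaussianPDFReal_nonneg _ _ _)]
  rfl

@[fun_prop]
lemma Measurable.samplingDensity {α : Type*} [MeasurableSpace α] (J : ℕ) {m s y v : α → ℝ}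
    (hm : Measurable m) (hs : Measurable s) (hy : Measurable y) (hv : Measurable v) :
    Measurable fun a => samplingDensity J (m a) (s a) (y a) (v a) := by
  unfold _root_.samplingDensity
  refine Measurable.mul ?_ ?_
  · exact measurable_uncurry_gaussianPDFReal.comp
      (f := fun a => (m a, (s a ^ 2 / J).toNNReal, y a)) (by fun_prop)
  · unfold gammaPDFReal
    exact Measurable.ite (measurableSet_le measurable_const hv) (by fun_prop) measurable_const

lemma shapeK_pos {J : ℕ} (hJ : 1 < J) : 0 < shapeK J := by
  have : (1 : ℝ) < J := by exact_mod_cast hJ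
  unfold shapeK
  linarith

/-- At `v = 0` this rests on $J>3$: the exponent $k-1$ is nonzero, so the power of 0 vanishes. Later
integrability statements can thus cover every `v`. -/
lemma samplingDensity_of_nonpos {J : ℕ} (hJ : 3 < J) (m s y : ℝ) {v : ℝ} (hv : v ≤ 0) :
    samplingDensity J m s y v = 0 := by
  have : (3 : ℝ) < J := by exact_mod_cast hJ
  have hk : shapeK J - 1 ≠ 0 := by unfold shapeK; linarith
  rcases hv.lt_or_eq with hv | rfl
  · simp [samplingDensity, gammaPDFReal, hv.not_ge]
  · simp [samplingDensity, gammaPDFReal, Real.zero_rpow hk]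

lemma samplingDensity_pos {J : ℕ} (hJ : 1 < J) (m y : ℝ) {s v : ℝ} (hs : 0 < s) (hv : 0 < v) :
    0 < samplingDensity J m s y v := by
  have hJ0 : (0 : ℝ) < J := by positivity
  have hk := shapeK_pos hJ
  refine mul_pos (gaussianPDFReal_pos _ _ _ ?_) (gammaPDFReal_pos hk (by positivity) hv)
  rw [ne_eq, Real.toNNReal_eq_zero, not_le]
  positivity

/-! ### Joint law of statistics and parameters, and the Bayes posterior. -/

section Joint

variable {J : ℕ} {G : Measure (ℝ × ℝ)}

lemma mixtureDensity_nonneg (hJ : 1 < J) (hG : ∀ᵐ p ∂G, 0 < p.2) (y v : ℝ) :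
    0 ≤ mixtureDensity J G y v := integral_nonneg_of_ae (by
  filter_upwards [hG] with p hp using samplingDensity_nonneg hJ hp _ _)

lemma ofReal_mixtureDensity (hJ : 1 < J) (hG : ∀ᵐ p ∂G, 0 < p.2) {y v : ℝ}
    (hint : Integrable (fun p : ℝ × ℝ => samplingDensity J p.1 p.2 y v) G) :
    ENNReal.ofReal (mixtureDensity J G y v) =
      ∫⁻ p, ENNReal.ofReal (samplingDensity J p.1 p.2 y v) ∂G :=
  ofReal_integral_eq_lintegral_ofReal hint (by
    filter_upwards [hG] with p hp using samplingDensity_nonneg hJ hp _ _)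

variable [IsProbabilityMeasure G]

/-- The joint law of (sample mean, sample variance) and the parameters. -/
noncomputable def statParamLaw (J : ℕ) (G : Measure (ℝ × ℝ)) : Measure ((ℝ × ℝ) × (ℝ × ℝ)) :=
  ((volume : Measure (ℝ × ℝ)).prod G).withDensity fun x =>
    ENNReal.ofReal (samplingDensity J x.2.1 x.2.2 x.1.1 x.1.2)

lemma map_prod_gaussian_eq_statParamLaw (hJ : 1 < J) (hG : ∀ᵐ p ∂G, 0 < p.2) :
    (G.prod (Measure.pi fun _ : Fin J => gaussianReal 0 1)).map
      (fun x => ((x.1.1 + x.1.2 * sampleMean x.2, x.1.2 ^ 2 * sampleVar x.2), x.1)) =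
    statParamLaw J G := by
  refine Measure.ext_of_lintegral _ fun F hF => ?_
  have hT : Measurable fun x : (ℝ × ℝ) × (Fin J → ℝ) =>
      ((x.1.1 + x.1.2 * sampleMean x.2, x.1.2 ^ 2 * sampleVar x.2), x.1) := by fun_prop
  rw [lintegral_map hF hT, lintegral_prod _ (by fun_prop), statParamLaw,
    lintegral_withDensity_eq_lintegral_mul _ (by fun_prop) hF,
    lintegral_prod_symm _ (by fun_prop)]
  refine lintegral_congr_ae ?_
  filter_upwards [hG] with p hp
  have hF' : Measurable fun q : ℝ × ℝ => F (q, p) := by fun_prop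
  calc _ = ∫⁻ q, F (q, p) ∂((Measure.pi fun _ : Fin J => gaussianReal 0 1).map
        (fun e => (p.1 + p.2 * sampleMean e, p.2 ^ 2 * sampleVar e))) := by
        rw [lintegral_map hF' (by fun_prop)]
    _ = _ := by
        rw [map_sampleMean_sampleVar_eq_withDensity hJ p.1 hp,
          lintegral_withDensity_eq_lintegral_mul _ (by fun_prop) hF']
        rfl

lemma lintegral_statParamLaw {F : (ℝ × ℝ) × (ℝ × ℝ) → ENNReal} (hF : Measurable F) :
    ∫⁻ x, F x ∂(statParamLaw J G) =
      ∫⁻ q, ∫⁻ p, ENNReal.ofReal (samplingDensity J p.1 p.2 q.1 q.2) * F (q, p) ∂G := by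
  rw [statParamLaw, lintegral_withDensity_eq_lintegral_mul _ (by fun_prop) hF,
    lintegral_prod _ (by fun_prop)]
  rfl

lemma measurable_mixtureDensity :
    Measurable fun q : ℝ × ℝ => mixtureDensity J G q.1 q.2 := by
  have : StronglyMeasurable (Function.uncurry fun (q p : ℝ × ℝ) =>
      samplingDensity J p.1 p.2 q.1 q.2) := Measurable.stronglyMeasurable (by fun_prop)
  exact this.integral_prod_right.measurable

lemma mixtureDensity_pos (hJ : 1 < J) (hG : ∀ᵐ p ∂G, 0 < p.2) {y v : ℝ} (hv : 0 < v)
    (hint : Integrable (fun p : ℝ × ℝ => samplingDensity J p.1 p.2 y v) G) :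
    0 < mixtureDensity J G y v := by
  have hpos : ∀ᵐ p ∂G, 0 < samplingDensity J p.1 p.2 y v := by
    filter_upwards [hG] with p hp using samplingDensity_pos hJ _ _ hp hv
  rw [mixtureDensity, integral_pos_iff_support_of_nonneg_ae (hpos.mono fun _ h => h.le) hint]
  have h1 : G (Function.support fun p : ℝ × ℝ => samplingDensity J p.1 p.2 y v) = 1 :=
    prob_compl_eq_zero_iff₀ hint.aestronglyMeasurable.nullMeasurableSet_support |>.1
      (hpos.mono fun p hp => hp.ne')
  rw [h1]
  exact one_pos

lemma fst_statParamLaw (hJ : 3 < J) (hG : ∀ᵐ p ∂G, 0 < p.2)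
    (hint : ∀ y v : ℝ, Integrable (fun p : ℝ × ℝ => samplingDensity J p.1 p.2 y v) G) :
    (statParamLaw J G).fst = (volume : Measure (ℝ × ℝ)).withDensity
      fun q => ENNReal.ofReal (mixtureDensity J G q.1 q.2) := by
  refine Measure.ext_of_lintegral _ fun F hF => ?_
  rw [Measure.fst, lintegral_map hF measurable_fst,
    lintegral_statParamLaw (F := fun x => F x.1) (by fun_prop),
    lintegral_withDensity_eq_lintegral_mul _ measurable_mixtureDensity.ennreal_ofReal hF]
  refine lintegral_congr fun q => ?_
  simp only [Pi.mul_apply]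
  rw [lintegral_mul_const _ (by fun_prop), ofReal_mixtureDensity (by omega) hG (hint _ _)]

/-- The Bayes posterior as a kernel. -/
noncomputable def posteriorKernel (J : ℕ) (G : Measure (ℝ × ℝ)) [IsProbabilityMeasure G] :
    Kernel (ℝ × ℝ) (ℝ × ℝ) :=
  Kernel.withDensity (Kernel.const _ G) fun q p =>
    (ENNReal.ofReal (mixtureDensity J G q.1 q.2))⁻¹ *
      ENNReal.ofReal (samplingDensity J p.1 p.2 q.1 q.2)

lemma measurable_posterior_density : Measurable (Function.uncurry fun (q p : ℝ × ℝ) =>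
    (ENNReal.ofReal (mixtureDensity J G q.1 q.2))⁻¹ *
      ENNReal.ofReal (samplingDensity J p.1 p.2 q.1 q.2)) := by
  have h := (measurable_mixtureDensity (J := J) (G := G)).ennreal_ofReal.inv
  exact (h.comp measurable_fst).mul (by fun_prop)

lemma posteriorKernel_apply (q : ℝ × ℝ) : posteriorKernel J G q = posteriorLaw J G q.1 q.2 := by
  rw [posteriorKernel, Kernel.withDensity_apply _ measurable_posterior_density, Kernel.const_apply,
    posteriorLaw]
  exact withDensity_smul _ (by fun_prop)

lemma isProbabilityMeasure_posteriorLaw (hJ : 1 < J) (hG : ∀ᵐ p ∂G, 0 < p.2) {y v : ℝ} (hv : 0 < v)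
    (hint : Integrable (fun p : ℝ × ℝ => samplingDensity J p.1 p.2 y v) G) :
    IsProbabilityMeasure (posteriorLaw J G y v) := by
  refine ⟨?_⟩
  rw [posteriorLaw, Measure.smul_apply, withDensity_apply _ .univ, setLIntegral_univ,
    ← ofReal_mixtureDensity hJ hG hint, smul_eq_mul]
  exact ENNReal.inv_mul_cancel
    (by simpa using mixtureDensity_pos hJ hG hv hint) ENNReal.ofReal_ne_top

lemma isFiniteKernel_posteriorKernel (hJ : 3 < J) (hG : ∀ᵐ p ∂G, 0 < p.2)
    (hint : ∀ y v : ℝ, Integrable (fun p : ℝ × ℝ => samplingDensity J p.1 p.2 y v) G) :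
    IsFiniteKernel (posteriorKernel J G) := by
  refine ⟨⟨1, ENNReal.one_lt_top, fun q => ?_⟩⟩
  rw [posteriorKernel_apply]
  rcases lt_or_ge 0 q.2 with hv | hv
  · have := isProbabilityMeasure_posteriorLaw (by omega) hG hv (hint q.1 q.2)
    exact prob_le_one
  -- Here the normalising factor is $0^{-1}=\infty$, but it multiplies the zero measure.
  · simp [posteriorLaw, samplingDensity_of_nonpos hJ _ _ _ hv]

/-- Where $f_G>0$ the factor $f_G$ cancels the posterior's normalisation; for `v ≤ 0` both densities
vanish. This disintegration identifies the conditional law. -/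
lemma compProd_posteriorKernel (hJ : 3 < J) (hG : ∀ᵐ p ∂G, 0 < p.2)
    (hint : ∀ y v : ℝ, Integrable (fun p : ℝ × ℝ => samplingDensity J p.1 p.2 y v) G) :
    statParamLaw J G = (volume : Measure (ℝ × ℝ)).withDensity
      (fun q => ENNReal.ofReal (mixtureDensity J G q.1 q.2)) ⊗ₘ posteriorKernel J G := by
  have := isFiniteKernel_posteriorKernel hJ hG hint
  refine Measure.ext_of_lintegral _ fun F hF => ?_
  have hinner : Measurable fun q => ∫⁻ p, F (q, p) ∂(posteriorKernel J G q) :=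
    hF.lintegral_kernel_prod_right'
  rw [lintegral_statParamLaw hF, Measure.lintegral_compProd hF,
    lintegral_withDensity_eq_lintegral_mul _ measurable_mixtureDensity.ennreal_ofReal hinner]
  refine lintegral_congr fun q => ?_
  have hFq : Measurable fun p => F (q, p) := by fun_prop
  simp only [Pi.mul_apply]
  rw [posteriorKernel_apply, posteriorLaw, lintegral_smul_measure,
    lintegral_withDensity_eq_lintegral_mul _ (by fun_prop) hFq, smul_eq_mul, ← mul_assoc]
  rcases lt_or_ge 0 q.2 with hv | hv
  · rw [ENNReal.mul_inv_cancel
      (by simpa using mixtureDensity_pos (by omega) hG hv (hint q.1 q.2)) ENNReal.ofReal_ne_top,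
      one_mul]
    rfl
  · simp [samplingDensity_of_nonpos hJ _ _ _ hv]

variable {Ω : Type*} [MeasurableSpace Ω] {P : Measure Ω}
  {mu sigma : Ω → ℝ} {eps Y : Fin J → Ω → ℝ}

lemma IsHeteroskedasticModel.hasLaw_stat_param
    (hmodel : IsHeteroskedasticModel P G mu sigma eps Y) (hJ : 1 < J) (hG : ∀ᵐ p ∂G, 0 < p.2) :
    HasLaw (fun ω => ((sampleMean fun j => Y j ω, sampleVar fun j => Y j ω), (mu ω, sigma ω)))
      (statParamLaw J G) P := by
  have h := hmodel.params_law.prodMk_of_hasCondDistrib hmodel.noise_law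
  rw [Measure.compProd_const] at h
  have hT : HasLaw (fun x : (ℝ × ℝ) × (Fin J → ℝ) =>
      ((x.1.1 + x.1.2 * sampleMean x.2, x.1.2 ^ 2 * sampleVar x.2), x.1)) (statParamLaw J G)
      (G.prod (Measure.pi fun _ : Fin J => gaussianReal 0 1)) :=
    ⟨Measurable.aemeasurable (by fun_prop), map_prod_gaussian_eq_statParamLaw hJ hG⟩
  refine (hT.fun_comp h).congr ?_
  filter_upwards [ae_all_iff.2 hmodel.obs_eq] with ω hω
  simp only [hω, sampleMean_affine (by omega : J ≠ 0), sampleVar_affine (by omega : J ≠ 0)]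

lemma IsHeteroskedasticModel.hasLaw_stat
    (hmodel : IsHeteroskedasticModel P G mu sigma eps Y) (hJ : 3 < J) (hG : ∀ᵐ p ∂G, 0 < p.2)
    (hint : ∀ y v : ℝ, Integrable (fun p : ℝ × ℝ => samplingDensity J p.1 p.2 y v) G) :
    HasLaw (fun ω => (sampleMean fun j => Y j ω, sampleVar fun j => Y j ω))
      ((volume : Measure (ℝ × ℝ)).withDensity
        fun q => ENNReal.ofReal (mixtureDensity J G q.1 q.2)) P := by
  have h := hmodel.hasLaw_stat_param (by omega) hG
  rw [← fst_statParamLaw hJ hG hint]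
  exact HasLaw.fun_comp (Y := Prod.fst) ⟨measurable_fst.aemeasurable, rfl⟩ h

lemma IsHeteroskedasticModel.condDistrib_param_ae_eq [IsProbabilityMeasure P]
    (hmodel : IsHeteroskedasticModel P G mu sigma eps Y) (hJ : 3 < J) (hG : ∀ᵐ p ∂G, 0 < p.2)
    (hint : ∀ y v : ℝ, Integrable (fun p : ℝ × ℝ => samplingDensity J p.1 p.2 y v) G) :
    ∀ᵐ q ∂(P.map fun ω => (sampleMean fun j => Y j ω, sampleVar fun j => Y j ω)),
      condDistrib (fun ω => (mu ω, sigma ω))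
        (fun ω => (sampleMean fun j => Y j ω, sampleVar fun j => Y j ω)) P q
        = posteriorLaw J G q.1 q.2 := by
  have := isFiniteKernel_posteriorKernel hJ hG hint
  have h := condDistrib_ae_eq_of_measure_eq_compProd (μ := P) (κ := posteriorKernel J G)
    (fun ω => (sampleMean fun j => Y j ω, sampleVar fun j => Y j ω))
    hmodel.params_law.aemeasurable (by
      rw [(hmodel.hasLaw_stat_param (by omega) hG).map_eq,
        (hmodel.hasLaw_stat hJ hG hint).map_eq, compProd_posteriorKernel hJ hG hint])
  filter_upwards [h] with q hq
  rw [hq, posteriorKernel_apply]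

/-- The total integral of $f_G$ is the mass of a marginal of a probability law. Fubini then gives
integrable sections for almost every `y`. -/
lemma integrable_mixtureDensity_prod (hJ : 3 < J) (hG : ∀ᵐ p ∂G, 0 < p.2)
    (hint : ∀ y v : ℝ, Integrable (fun p : ℝ × ℝ => samplingDensity J p.1 p.2 y v) G) :
    Integrable fun q : ℝ × ℝ => mixtureDensity J G q.1 q.2 := by
  refine ⟨measurable_mixtureDensity.aestronglyMeasurable, ?_⟩
  have h0 : ∀ q : ℝ × ℝ, 0 ≤ mixtureDensity J G q.1 q.2 := fun q =>
    mixtureDensity_nonneg (by omega) hG q.1 q.2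
  rw [hasFiniteIntegral_iff_ofReal (ae_of_all _ h0)]
  have h := fst_statParamLaw hJ hG hint
  rw [← setLIntegral_univ, ← withDensity_apply _ .univ, ← h,
    ← map_prod_gaussian_eq_statParamLaw (by omega) hG]
  have : IsProbabilityMeasure
    ((G.prod (Measure.pi fun _ : Fin J => gaussianReal 0 1)).map
      (fun x => ((x.1.1 + x.1.2 * sampleMean x.2, x.1.2 ^ 2 * sampleVar x.2), x.1))) :=
    Measure.isProbabilityMeasure_map (by fun_prop)
  exact measure_lt_top _ _

end Joint

/-! ### Uniform bounds on the weighted sampling density. -/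

section Bounds

lemma exists_rpow_mul_exp_neg_sq_le {p b : ℝ} (hp : 0 ≤ p) (hb : 0 < b) :
    ∃ C, ∀ t : ℝ, 0 < t → t ^ p * Real.exp (-(b * t ^ 2)) ≤ C := by
  obtain ⟨m, hm⟩ := exists_nat_ge p
  -- From $t^p\le 1+t^{2m}$ and the exponential series term $(bt^2)^m/m!\le e^{bt^2}$.
  refine ⟨1 + m.factorial / b ^ m, fun t ht => ?_⟩
  have h1 : t ^ p ≤ 1 + (t ^ 2) ^ m := by
    rcases le_total t 1 with h | h
    · have := Real.rpow_le_one ht.le h hp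
      have : 0 ≤ (t ^ 2) ^ m := by positivity
      linarith
    · calc t ^ p ≤ t ^ (m : ℝ) := Real.rpow_le_rpow_of_exponent_le h hm
        _ = t ^ m := Real.rpow_natCast t m
        _ ≤ (t ^ 2) ^ m := by gcongr; nlinarith
        _ ≤ 1 + (t ^ 2) ^ m := by linarith
  have h2 := Real.pow_div_factorial_le_exp (b * t ^ 2) (by positivity) m
  have h3 : (t ^ 2) ^ m ≤ m.factorial / b ^ m * Real.exp (b * t ^ 2) := by
    rw [mul_pow, div_le_iff₀ (by positivity)] at h2
    rw [div_mul_eq_mul_div, le_div_iff₀ (by positivity)]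
    linarith
  have h4 : 1 ≤ Real.exp (b * t ^ 2) := Real.one_le_exp (by positivity)
  rw [Real.exp_neg, ← div_eq_mul_inv, div_le_iff₀ (Real.exp_pos _), add_mul, one_mul]
  linarith

lemma exists_one_add_abs_mul_exp_neg_sq_le {a : ℝ} (ha : 0 < a) :
    ∃ C, ∀ x : ℝ, (1 + |x|) * Real.exp (-(a * x ^ 2)) ≤ C := by
  refine ⟨2 + 1 / a, fun x => ?_⟩
  rw [Real.exp_neg, ← div_eq_mul_inv, div_le_iff₀ (Real.exp_pos _)]
  have h1 := Real.add_one_le_exp (a * x ^ 2)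
  have h2 : |x| ≤ 1 + x ^ 2 := by
    rw [← sq_abs]; nlinarith [sq_nonneg (|x| - 1), abs_nonneg x]
  calc 1 + |x| ≤ 2 + x ^ 2 := by linarith
    _ ≤ (2 + 1 / a) * (a * x ^ 2 + 1) := by
        have : (2 + 1 / a) * (a * x ^ 2 + 1) = 2 + x ^ 2 + (2 * a * x ^ 2 + 1 / a) := by
          field_simp; ring
        rw [this]
        have : 0 ≤ 2 * a * x ^ 2 + 1 / a := by positivity
        linarith
    _ ≤ _ := by gcongr

/-- The variables $s^{-1}$ and $(y-m)/s$ separate the two decay factors. The power $2k+1$ collects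
$s^{-2k}$ from the gamma rate and $s^{-1}$ from the Gaussian normalisation. -/
lemma samplingDensity_eq {J : ℕ} (hJ : 1 < J) (m y : ℝ) {s v : ℝ} (hs : 0 < s) (hv : 0 ≤ v) :
    samplingDensity J m s y v =
      √J / √(2 * Real.pi) * (shapeK J ^ shapeK J / Real.Gamma (shapeK J)) * v ^ (shapeK J - 1) *
        (s⁻¹ ^ (2 * shapeK J + 1) * Real.exp (-(shapeK J * v * s⁻¹ ^ 2))) *
        Real.exp (-(J / 2 * ((y - m) / s) ^ 2)) := by
  have hJ0 : (0 : ℝ) < J := by positivity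
  have hk := shapeK_pos hJ
  have hs2 : 0 < s ^ 2 := by positivity
  rw [samplingDensity, gaussianPDFReal, gammaPDFReal, if_pos hv,
    Real.coe_toNNReal _ (by positivity)]
  have h1 : √(2 * Real.pi * (s ^ 2 / J)) = √(2 * Real.pi) * (s / √J) := by
    rw [Real.sqrt_mul (by positivity), Real.sqrt_div (by positivity), Real.sqrt_sq hs.le]
  have h2 : s⁻¹ ^ (2 * shapeK J + 1) = (s ^ 2)⁻¹ ^ shapeK J * s⁻¹ := by
    rw [Real.rpow_add (by positivity), Real.rpow_one, Real.rpow_mul (by positivity), Real.rpow_two,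
      inv_pow]
  have h3 : -(y - m) ^ 2 / (2 * (s ^ 2 / J)) = -(J / 2 * ((y - m) / s) ^ 2) := by
    field_simp
  have h4 : shapeK J / s ^ 2 * v = shapeK J * v * s⁻¹ ^ 2 := by field_simp
  rw [h1, h2, h3, h4, div_eq_mul_inv (shapeK J) (s ^ 2), Real.mul_rpow hk.le (by positivity)]
  have : √(J : ℝ) ≠ 0 := (Real.sqrt_pos.2 hJ0).ne'
  have : √(2 * Real.pi) ≠ 0 := (Real.sqrt_pos.2 (by positivity)).ne'
  field_simp

/-- Small `s` is controlled by $e^{-kv/s^2}$, large `s` by $s^{-(2k+1)}$, hence the limit on `q`;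
the Gaussian factor absorbs $1+|y-m|/s$. -/
lemma exists_rpow_mul_samplingDensity_le {J : ℕ} (hJ : 1 < J) {v q : ℝ} (hv : 0 < v)
    (hq : q ≤ 2 * shapeK J + 1) :
    ∃ C, ∀ m y s : ℝ, 0 < s →
      s ^ q * (1 + |y - m| / s) * samplingDensity J m s y v ≤ C := by
  have hJ0 : (0 : ℝ) < J := by positivity
  have hk := shapeK_pos hJ
  obtain ⟨C₁, hC₁⟩ := exists_rpow_mul_exp_neg_sq_le (sub_nonneg.2 hq) (mul_pos hk hv)
  obtain ⟨C₂, hC₂⟩ := exists_one_add_abs_mul_exp_neg_sq_le (half_pos hJ0)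
  set B : ℝ := √J / √(2 * Real.pi) * (shapeK J ^ shapeK J / Real.Gamma (shapeK J)) *
    v ^ (shapeK J - 1) with hB
  have hΓ := Real.Gamma_pos_of_pos hk
  have hB0 : 0 ≤ B := by positivity
  refine ⟨B * (C₁ * C₂), fun m y s hs => ?_⟩
  have e : s ^ q * (1 + |y - m| / s) * samplingDensity J m s y v =
      B * ((s⁻¹ ^ (2 * shapeK J + 1 - q) * Real.exp (-(shapeK J * v * s⁻¹ ^ 2))) *
        ((1 + |(y - m) / s|) * Real.exp (-(J / 2 * ((y - m) / s) ^ 2)))) := by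
    have h : s⁻¹ ^ (2 * shapeK J + 1) = s⁻¹ ^ (2 * shapeK J + 1 - q) * (s ^ q)⁻¹ := by
      rw [← Real.inv_rpow hs.le, ← Real.rpow_add (by positivity)]
      congr 1
      ring
    have h' : s ^ q ≠ 0 := (Real.rpow_pos_of_pos hs q).ne'
    rw [samplingDensity_eq hJ m y hs hv.le, h, ← hB, abs_div, abs_of_pos hs]
    field_simp
  rw [e]
  have h1 := hC₁ s⁻¹ (by positivity)
  have h2 := hC₂ ((y - m) / s)
  refine mul_le_mul_of_nonneg_left (mul_le_mul h1 h2 (by positivity) ?_) hB0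
  exact le_trans (by positivity) h1

/-- A weight of moderate growth in the parameters times the sampling density is bounded,
uniformly in the sample mean and the parameters. -/
lemma exists_bound_weight_mul_samplingDensity {J : ℕ} (hJ : 1 < J) {v q : ℝ} (hv : 0 < v)
    (hq : q ≤ 2 * shapeK J + 1) :
    ∃ C, ∀ m y s w : ℝ, 0 < s → |w| ≤ s ^ q * (1 + |y - m| / s) →
      ‖w * samplingDensity J m s y v‖ ≤ C := by
  obtain ⟨C, hC⟩ := exists_rpow_mul_samplingDensity_le hJ hv hq
  refine ⟨C, fun m y s w hs hw => le_trans ?_ (hC m y s hs)⟩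
  have h := (samplingDensity_pos hJ m y hs hv).le
  rw [Real.norm_eq_abs, abs_mul, abs_of_nonneg h]
  exact mul_le_mul_of_nonneg_right hw h

end Bounds

/-! ### Posterior moments exist for arbitrary mixing laws. -/

section Integrability

variable {J : ℕ} {G : Measure (ℝ × ℝ)} [IsProbabilityMeasure G]

lemma integrable_weight_mul_samplingDensity (hJ : 1 < J) (hG : ∀ᵐ p ∂G, 0 < p.2) {y v q : ℝ}
    (hv : 0 < v) (hq : q ≤ 2 * shapeK J + 1) {w : ℝ × ℝ → ℝ} (hw : Measurable w)
    (hwb : ∀ p : ℝ × ℝ, 0 < p.2 → |w p| ≤ p.2 ^ q * (1 + |y - p.1| / p.2)) :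
    Integrable (fun p : ℝ × ℝ => w p * samplingDensity J p.1 p.2 y v) G := by
  obtain ⟨C, hC⟩ := exists_bound_weight_mul_samplingDensity hJ hv hq
  refine Integrable.of_bound (C := C) (by fun_prop) ?_
  filter_upwards [hG] with p hp using hC _ _ _ _ hp (hwb p hp)

lemma integrable_samplingDensity (hJ : 3 < J) (hG : ∀ᵐ p ∂G, 0 < p.2) (y v : ℝ) :
    Integrable (fun p : ℝ × ℝ => samplingDensity J p.1 p.2 y v) G := by
  rcases lt_or_ge 0 v with hv | hv
  · have hk := shapeK_pos (by omega : 1 < J)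
    have := integrable_weight_mul_samplingDensity (J := J) (by omega) hG (y := y) hv (q := 0)
      (by linarith) (measurable_const (a := (1 : ℝ))) (fun p hp => by
        rw [Real.rpow_zero, abs_one]
        have : 0 ≤ |y - p.1| / p.2 := by positivity
        linarith)
    simpa using this
  · simp [samplingDensity_of_nonpos hJ _ _ _ hv]

lemma integrable_sigma_mul_samplingDensity (hJ : 1 < J) (hG : ∀ᵐ p ∂G, 0 < p.2) (y : ℝ) {v : ℝ}
    (hv : 0 < v) : Integrable (fun p : ℝ × ℝ => p.2 * samplingDensity J p.1 p.2 y v) G := by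
  have hk := shapeK_pos hJ
  refine integrable_weight_mul_samplingDensity hJ hG hv (q := 1) (by linarith) measurable_snd
    fun p hp => ?_
  rw [Real.rpow_one, abs_of_pos hp]
  have : 0 ≤ |y - p.1| / p.2 := by positivity
  nlinarith

lemma two_le_shapeK (hJ : 3 < J) : (2 : ℝ) ≤ 2 * shapeK J + 1 := by
  have : (3 : ℝ) < J := by exact_mod_cast hJ
  unfold shapeK
  linarith

lemma integrable_sigma_sq_mul_samplingDensity (hJ : 3 < J) (hG : ∀ᵐ p ∂G, 0 < p.2) (y : ℝ) {v : ℝ}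
    (hv : 0 < v) : Integrable (fun p : ℝ × ℝ => p.2 ^ 2 * samplingDensity J p.1 p.2 y v) G := by
  refine integrable_weight_mul_samplingDensity (by omega) hG hv (two_le_shapeK hJ)
    (by fun_prop) fun p hp => ?_
  rw [Real.rpow_two, abs_of_pos (by positivity)]
  have : 0 ≤ |y - p.1| / p.2 := by positivity
  nlinarith [sq_nonneg p.2]

lemma abs_le_rpow_one_mul {p : ℝ × ℝ} (hp : 0 < p.2) (y : ℝ) :
    |y - p.1| ≤ p.2 ^ (1 : ℝ) * (1 + |y - p.1| / p.2) := by
  rw [Real.rpow_one, mul_add, mul_div_cancel₀ _ hp.ne']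
  linarith

lemma integrable_sub_mul_samplingDensity (hJ : 1 < J) (hG : ∀ᵐ p ∂G, 0 < p.2) (y : ℝ) {v : ℝ}
    (hv : 0 < v) :
    Integrable (fun p : ℝ × ℝ => (y - p.1) * samplingDensity J p.1 p.2 y v) G := by
  have hk := shapeK_pos hJ
  exact integrable_weight_mul_samplingDensity hJ hG hv (q := 1) (by linarith) (by fun_prop)
    fun p hp => abs_le_rpow_one_mul hp y

/-- The bounds control $y-\mu$ rather than $\mu$, so $\mu$ is written as $y-(y-\mu)$. -/
lemma integrable_mu_mul_samplingDensity (hJ : 3 < J) (hG : ∀ᵐ p ∂G, 0 < p.2) (y : ℝ) {v : ℝ}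
    (hv : 0 < v) : Integrable (fun p : ℝ × ℝ => p.1 * samplingDensity J p.1 p.2 y v) G := by
  have h := ((integrable_samplingDensity hJ hG y v).const_mul y).sub
    (integrable_sub_mul_samplingDensity (J := J) (by omega) hG y hv)
  refine h.congr (ae_of_all _ fun p => ?_)
  simp only [Pi.sub_apply]
  ring

end Integrability

/-! ### Differentiation in the sample mean. -/

section Derivative

variable {J : ℕ} {G : Measure (ℝ × ℝ)} [IsProbabilityMeasure G]

lemma hasDerivAt_samplingDensity (hJ : 1 < J) (m y v : ℝ) {s : ℝ} (hs : 0 < s) :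
    HasDerivAt (fun x => samplingDensity J m s x v)
      (-(J * (y - m) / s ^ 2) * samplingDensity J m s y v) y := by
  have hJ0 : (0 : ℝ) < J := by positivity
  unfold samplingDensity gaussianPDFReal
  rw [Real.coe_toNNReal _ (by positivity)]
  have h1 : HasDerivAt (fun x : ℝ => -(x - m) ^ 2 / (2 * (s ^ 2 / J)))
      (-(J * (y - m) / s ^ 2)) y := by
    have := ((((hasDerivAt_id y).sub_const m).pow 2).neg).div_const (2 * (s ^ 2 / J))
    refine this.congr_deriv ?_
    simp only [id_eq]
    field_simp
    norm_num [mul_comm]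
  have h2 := (h1.exp.const_mul (√(2 * Real.pi * (s ^ 2 / J)))⁻¹).mul_const
    (gammaPDFReal (shapeK J) (shapeK J / s ^ 2) v)
  refine h2.congr_deriv ?_
  ring

/-- Differentiation of a weighted mixture density in the sample mean. -/
lemma hasDerivAt_integral_weight_mul_samplingDensity (hJ : 1 < J) (hG : ∀ᵐ p ∂G, 0 < p.2)
    {v q : ℝ} (hv : 0 < v) (hq : q ≤ 2 * shapeK J + 1) {w : ℝ × ℝ → ℝ} (hw : Measurable w)
    (hint : ∀ y, Integrable (fun p : ℝ × ℝ => w p * samplingDensity J p.1 p.2 y v) G)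
    (hwb : ∀ p : ℝ × ℝ, 0 < p.2 → |w p| ≤ p.2 ^ (q + 1)) (y : ℝ) :
    HasDerivAt (fun x => ∫ p, w p * samplingDensity J p.1 p.2 x v ∂G)
      (∫ p, w p * (-(J * (y - p.1) / p.2 ^ 2) * samplingDensity J p.1 p.2 y v) ∂G) y := by
  obtain ⟨C, hC⟩ := exists_bound_weight_mul_samplingDensity hJ hv hq
  have hJ0 : (0 : ℝ) < J := by positivity
  -- The score costs $|x-\mu|/\sigma^2$; one of the two powers of $\sigma$ standardises the residual
  -- and the other lowers $\sigma^{q+1}$ to $\sigma^q$. So `J * C` dominates for every `x`.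
  refine (hasDerivAt_integral_of_dominated_loc_of_deriv_le (bound := fun _ => J * C)
    Filter.univ_mem (.of_forall fun x => (hint x).aestronglyMeasurable) (hint y) ?_ ?_
    (integrable_const _)
    (F' := fun x p => w p * (-(J * (x - p.1) / p.2 ^ 2) * samplingDensity J p.1 p.2 x v)) ?_).2
  · exact Measurable.aestronglyMeasurable (by fun_prop)
  · filter_upwards [hG] with p hp x _
    have e : w p * (-(J * (x - p.1) / p.2 ^ 2) * samplingDensity J p.1 p.2 x v) =
        J * ((-w p * (x - p.1) / p.2 ^ 2) * samplingDensity J p.1 p.2 x v) := by ring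
    rw [e, norm_mul, Real.norm_of_nonneg hJ0.le]
    refine mul_le_mul_of_nonneg_left (hC _ _ _ _ hp ?_) hJ0.le
    rw [abs_div, abs_mul, abs_neg, abs_of_pos (by positivity : 0 < p.2 ^ 2)]
    have hpq : 0 < p.2 ^ q := Real.rpow_pos_of_pos hp q
    calc |w p| * |x - p.1| / p.2 ^ 2 ≤ p.2 ^ (q + 1) * |x - p.1| / p.2 ^ 2 := by
          gcongr
          exact hwb p hp
      _ = p.2 ^ q * (|x - p.1| / p.2) := by
          rw [Real.rpow_add hp, Real.rpow_one]
          field_simp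
      _ ≤ _ := by gcongr; linarith
  · filter_upwards [hG] with p hp x _
    exact (hasDerivAt_samplingDensity hJ p.1 x v hp).const_mul (w p)

lemma differentiableAt_mixtureDensity (hJ : 3 < J) (hG : ∀ᵐ p ∂G, 0 < p.2) {v : ℝ} (hv : 0 < v)
    (y : ℝ) :
    DifferentiableAt ℝ (fun x => mixtureDensity J G x v) y := by
  have hk := shapeK_pos (by omega : 1 < J)
  have h := hasDerivAt_integral_weight_mul_samplingDensity (J := J) (by omega) hG hv (q := -1)
    (by linarith) (measurable_const (a := (1 : ℝ)))
    (fun x => by simpa using integrable_samplingDensity hJ hG x v) (fun p hp => by simp) y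
  simp only [one_mul] at h
  exact h.differentiableAt

/-- The weight $\sigma^2$ cancels the denominator of the Gaussian score, leaving $J(\mu-y)$. -/
lemma hasDerivAt_integral_sigma_sq_mul_samplingDensity (hJ : 3 < J) (hG : ∀ᵐ p ∂G, 0 < p.2)
    {v : ℝ} (hv : 0 < v) (y : ℝ) :
    HasDerivAt (fun x => ∫ p, p.2 ^ 2 * samplingDensity J p.1 p.2 x v ∂G)
      (J * (∫ p, p.1 * samplingDensity J p.1 p.2 y v ∂G - y * mixtureDensity J G y v)) y := by
  have hk := shapeK_pos (by omega : 1 < J)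
  have h := hasDerivAt_integral_weight_mul_samplingDensity (J := J) (by omega) hG hv (q := 1)
    (by linarith) (w := fun p => p.2 ^ 2) (by fun_prop)
    (fun x => integrable_sigma_sq_mul_samplingDensity hJ hG x hv)
    (fun p hp => by
      rw [abs_of_pos (by positivity), ← Real.rpow_two]
      norm_num) y
  refine h.congr_deriv ?_
  rw [mixtureDensity, ← integral_const_mul y, ← integral_sub
    (integrable_mu_mul_samplingDensity hJ hG y hv)
    ((integrable_samplingDensity hJ hG y v).const_mul y), ← integral_const_mul]
  refine integral_congr_ae ?_
  filter_upwards [hG] with p hp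
  field_simp
  ring

end Derivative

/-! ### Tail integrals of the gamma density. -/

section GammaTail

/-- The factor $t^{a-1}$ of the gamma density cancels, leaving a pure exponential in `t`. -/
lemma rpow_mul_gammaPDFReal {a r v t : ℝ} (hv : 0 < v) (ht : v < t) :
    (v / t) ^ (a - 1) * gammaPDFReal a r t =
      r ^ a / Real.Gamma a * v ^ (a - 1) * Real.exp (-r * t) := by
  have ht0 : 0 < t := hv.trans ht
  rw [gammaPDFReal, if_pos ht0.le, Real.div_rpow hv.le ht0.le, neg_mul]
  have := (Real.rpow_pos_of_pos ht0 (a - 1)).ne'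
  field_simp

lemma integrableOn_rpow_mul_gammaPDFReal {a r v : ℝ} (hr : 0 < r) (hv : 0 < v) :
    IntegrableOn (fun t => (v / t) ^ (a - 1) * gammaPDFReal a r t) (Ioi v) := by
  refine IntegrableOn.congr_fun
    ((integrableOn_exp_mul_Ioi (neg_lt_zero.2 hr) v).const_mul (r ^ a / Real.Gamma a * v ^ (a - 1)))
    (fun t ht => ?_) measurableSet_Ioi
  exact (rpow_mul_gammaPDFReal hv ht).symm

lemma integral_rpow_mul_gammaPDFReal {a r v : ℝ} (hr : 0 < r) (hv : 0 < v) :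
    ∫ t in Ioi v, (v / t) ^ (a - 1) * gammaPDFReal a r t = 1 / r * gammaPDFReal a r v := by
  rw [setIntegral_congr_fun measurableSet_Ioi fun t ht => rpow_mul_gammaPDFReal hv ht,
    integral_const_mul, integral_exp_mul_Ioi (neg_lt_zero.2 hr), gammaPDFReal, if_pos hv.le,
    neg_mul]
  field_simp

lemma integrableOn_rpow_neg_half_mul_exp {r : ℝ} (hr : 0 < r) :
    IntegrableOn (fun x : ℝ => x ^ (1 / 2 - 1 : ℝ) * Real.exp (-(r * x))) (Ioi 0) := by
  have := integrableOn_rpow_mul_exp_neg_mul_rpow (p := 1) (s := 1 / 2 - 1) (b := r)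
    (by norm_num) one_pos hr
  simpa using this

lemma preimage_add_neg_Ioi (v : ℝ) : (fun x => x + -v) ⁻¹' Ioi 0 = Ioi v := by
  ext x
  simp [← sub_eq_add_neg]

/-- After the cancellation, shifting by `v` leaves the unnormalised gamma density of shape $1/2$ in
$t-v$. -/
lemma inv_sqrt_mul_rpow_mul_gammaPDFReal {a b r v t : ℝ} (hb : 0 ≤ b) (hv : 0 < v) (ht : v < t) :
    1 / √(b * (t - v)) * (v / t) ^ (a - 1) * gammaPDFReal a r t =
      gammaPDFReal a r v / √b * ((t + -v) ^ (1 / 2 - 1 : ℝ) * Real.exp (-(r * (t + -v)))) := by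
  have htv : 0 < t - v := sub_pos.2 ht
  rw [mul_assoc, rpow_mul_gammaPDFReal hv ht, gammaPDFReal, if_pos hv.le, Real.sqrt_mul hb,
    ← sub_eq_add_neg]
  have h1 : (t - v) ^ (1 / 2 - 1 : ℝ) = (√(t - v))⁻¹ := by
    rw [Real.sqrt_eq_rpow, ← Real.rpow_neg htv.le]
    norm_num
  have h2 : Real.exp (-r * t) = Real.exp (-(r * v)) * Real.exp (-(r * (t - v))) := by
    rw [← Real.exp_add]
    ring_nf
  rw [h1, h2]
  ring

lemma integrableOn_inv_sqrt_mul_rpow_mul_gammaPDFReal {a b r v : ℝ} (hb : 0 ≤ b) (hr : 0 < r)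
    (hv : 0 < v) :
    IntegrableOn (fun t => 1 / √(b * (t - v)) * (v / t) ^ (a - 1) * gammaPDFReal a r t)
      (Ioi v) := by
  have h := ((measurePreserving_add_right volume (-v)).integrableOn_comp_preimage
    (measurableEmbedding_addRight (-v))).2 (integrableOn_rpow_neg_half_mul_exp hr)
  rw [preimage_add_neg_Ioi] at h
  refine IntegrableOn.congr_fun (h.const_mul (gammaPDFReal a r v / √b))
    (fun t ht => ?_) measurableSet_Ioi
  exact (inv_sqrt_mul_rpow_mul_gammaPDFReal hb hv ht).symm

/-- For $b=k$ and $r=k/\sigma^2$ the factor $r^{-1/2}/\sqrt b$ equals $\sigma/k$, the source of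
$\sigma$ in (iii). -/
lemma integral_inv_sqrt_mul_rpow_mul_gammaPDFReal {a b r v : ℝ} (hb : 0 ≤ b) (hr : 0 < r)
    (hv : 0 < v) :
    ∫ t in Ioi v, 1 / √(b * (t - v)) * (v / t) ^ (a - 1) * gammaPDFReal a r t =
      gammaPDFReal a r v / √b * ((1 / r) ^ (1 / 2 : ℝ) * Real.Gamma (1 / 2)) := by
  rw [setIntegral_congr_fun measurableSet_Ioi
    fun t ht => inv_sqrt_mul_rpow_mul_gammaPDFReal hb hv ht, integral_const_mul]
  have h := (measurePreserving_add_right volume (-v)).setIntegral_preimage_emb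
    (measurableEmbedding_addRight (-v))
    (fun x : ℝ => x ^ (1 / 2 - 1 : ℝ) * Real.exp (-(r * x))) (Ioi 0)
  rw [preimage_add_neg_Ioi, Real.integral_rpow_mul_exp_neg_mul_Ioi one_half_pos hr] at h
  rw [h]

end GammaTail

/-! ### Averaging over the mixing law. -/

section Mixture

/-- By Tonelli, nonnegativity reduces joint integrability to that of the section integrals `W`. -/
lemma integrable_integral_of_nonneg {α β : Type*} [MeasurableSpace α] [MeasurableSpace β]
    {ν : Measure α} [SFinite ν] {ρ : Measure β} [SFinite ρ] {F : α → β → ℝ} {W : β → ℝ}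
    (hF : Measurable (Function.uncurry F)) (h0 : ∀ᵐ p ∂ρ, ∀ᵐ t ∂ν, 0 ≤ F t p)
    (hint : ∀ᵐ p ∂ρ, Integrable (fun t => F t p) ν) (hW : ∀ᵐ p ∂ρ, ∫ t, F t p ∂ν = W p)
    (hWint : Integrable W ρ) :
    Integrable (fun t => ∫ p, F t p ∂ρ) ν ∧ ∫ t, ∫ p, F t p ∂ρ ∂ν = ∫ p, W p ∂ρ := by
  have hprod : Integrable (Function.uncurry F) (ν.prod ρ) := by
    rw [integrable_prod_iff' hF.aestronglyMeasurable]
    refine ⟨hint, hWint.congr ?_⟩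
    filter_upwards [h0, hW] with p hp hpW
    rw [← hpW]
    refine integral_congr_ae ?_
    filter_upwards [hp] with t ht
    exact (Real.norm_of_nonneg ht).symm
  refine ⟨hprod.integral_prod_left, ?_⟩
  rw [integral_integral_swap hprod]
  exact integral_congr_ae hW

variable {J : ℕ} {G : Measure (ℝ × ℝ)}

lemma posteriorMean_eq (hJ : 1 < J) (hG : ∀ᵐ p ∂G, 0 < p.2) (h : ℝ × ℝ → ℝ) (y v : ℝ) :
    posteriorMean J G h y v =
      (∫ p, h p * samplingDensity J p.1 p.2 y v ∂G) / mixtureDensity J G y v := by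
  rw [posteriorMean, posteriorLaw, integral_smul_measure,
    integral_withDensity_eq_integral_toReal_smul (by fun_prop)
      (ae_of_all _ fun _ => ENNReal.ofReal_lt_top), ENNReal.toReal_inv,
    ENNReal.toReal_ofReal (mixtureDensity_nonneg hJ hG y v),
    smul_eq_mul, inv_mul_eq_div]
  congr 1
  refine integral_congr_ae ?_
  filter_upwards [hG] with p hp
  rw [ENNReal.toReal_ofReal (samplingDensity_nonneg hJ hp y v), smul_eq_mul, mul_comm]

variable [IsProbabilityMeasure G]

/-- Integrating out the Gaussian factor leaves the gamma density at `v`, which is bounded in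
$\sigma$. -/
lemma integrable_mixtureDensity_mean (hJ : 3 < J) (hG : ∀ᵐ p ∂G, 0 < p.2) {v : ℝ} (hv : 0 < v) :
    Integrable fun x => mixtureDensity J G x v := by
  have hJ0 : (0 : ℝ) < J := by positivity
  have hk := shapeK_pos (by omega : 1 < J)
  obtain ⟨C, hC⟩ := exists_rpow_mul_samplingDensity_le (J := J) (by omega) hv
    (q := 1) (by linarith)
  have hvar : ∀ p : ℝ × ℝ, 0 < p.2 → (p.2 ^ 2 / J).toNNReal ≠ 0 := fun p hp => by
    rw [ne_eq, Real.toNNReal_eq_zero, not_le]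
    positivity
  refine (integrable_integral_of_nonneg (ρ := G) (ν := volume)
    (F := fun x p => samplingDensity J p.1 p.2 x v)
    (W := fun p => gammaPDFReal (shapeK J) (shapeK J / p.2 ^ 2) v) (by fun_prop) ?_ ?_ ?_ ?_).1
  · filter_upwards [hG] with p hp
    exact ae_of_all _ fun x => samplingDensity_nonneg (by omega) hp x v
  · filter_upwards [hG] with p hp
    exact (integrable_gaussianPDFReal _ _).mul_const _
  · filter_upwards [hG] with p hp
    simp only [samplingDensity]
    rw [integral_mul_const, integral_gaussianPDFReal_eq_one _ (hvar p hp), one_mul]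
  · have hmeas : Measurable fun p : ℝ × ℝ => gammaPDFReal (shapeK J) (shapeK J / p.2 ^ 2) v := by
      simp only [gammaPDFReal, if_pos hv.le]
      fun_prop
    refine Integrable.of_bound (C := √(2 * Real.pi) / √J * C) hmeas.aestronglyMeasurable ?_
    filter_upwards [hG] with p hp
    rw [Real.norm_of_nonneg (gammaPDFReal_nonneg hk (by positivity) _)]
    -- At $y=\mu$ the Gaussian factor is $\sqrt J/(\sqrt{2\pi}\,\sigma)$, so the bound with `q = 1`
    -- is a bound on the gamma factor alone.
    have h := hC p.1 p.1 p.2 hp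
    have hs2 : √(2 * Real.pi * (p.2 ^ 2 / J)) = √(2 * Real.pi) * (p.2 / √J) := by
      rw [Real.sqrt_mul (by positivity), Real.sqrt_div (by positivity), Real.sqrt_sq hp.le]
    rw [samplingDensity, gaussianPDFReal, Real.coe_toNNReal _ (by positivity), hs2] at h
    simp only [sub_self, abs_zero, zero_div, add_zero, mul_one, Real.rpow_one, ne_eq,
      OfNat.ofNat_ne_zero, not_false_eq_true, zero_pow, neg_zero, Real.exp_zero] at h
    have hJs : 0 < √(J : ℝ) := Real.sqrt_pos.2 hJ0
    have hps : 0 < √(2 * Real.pi) := Real.sqrt_pos.2 (by positivity)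
    calc gammaPDFReal (shapeK J) (shapeK J / p.2 ^ 2) v = √(2 * Real.pi) / √J *
          (p.2 * ((√(2 * Real.pi) * (p.2 / √J))⁻¹ *
            gammaPDFReal (shapeK J) (shapeK J / p.2 ^ 2) v)) := by field_simp
      _ ≤ _ := by gcongr

lemma integral_rpow_mul_mixtureDensity (hJ : 3 < J) (hG : ∀ᵐ p ∂G, 0 < p.2) (y : ℝ) {v : ℝ}
    (hv : 0 < v) :
    IntegrableOn (fun t => (v / t) ^ (shapeK J - 1) * mixtureDensity J G y t) (Ioi v) ∧
    ∫ t in Ioi v, (v / t) ^ (shapeK J - 1) * mixtureDensity J G y t =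
      1 / shapeK J * ∫ p, p.2 ^ 2 * samplingDensity J p.1 p.2 y v ∂G := by
  have hk := shapeK_pos (by omega : 1 < J)
  have e : ∀ t m s : ℝ, (v / t) ^ (shapeK J - 1) * samplingDensity J m s y t =
      gaussianPDFReal m (s ^ 2 / J).toNNReal y *
        ((v / t) ^ (shapeK J - 1) * gammaPDFReal (shapeK J) (shapeK J / s ^ 2) t) := fun t m s => by
    rw [samplingDensity]; ring
  have h := integrable_integral_of_nonneg (ρ := G) (ν := volume.restrict (Ioi v))
    (F := fun t p => (v / t) ^ (shapeK J - 1) * samplingDensity J p.1 p.2 y t)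
    (W := fun p => 1 / shapeK J * (p.2 ^ 2 * samplingDensity J p.1 p.2 y v)) (by fun_prop)
    (by
      filter_upwards [hG] with p hp
      filter_upwards [ae_restrict_mem measurableSet_Ioi] with t ht
      have ht0 : 0 < t := hv.trans ht
      exact mul_nonneg (by positivity) (samplingDensity_nonneg (by omega) hp y t))
    (by
      filter_upwards [hG] with p hp
      simp only [e]
      exact (integrableOn_rpow_mul_gammaPDFReal (by positivity) hv).const_mul _)
    (by
      filter_upwards [hG] with p hp
      simp only [e]
      rw [integral_const_mul, integral_rpow_mul_gammaPDFReal (by positivity) hv, samplingDensity]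
      field_simp)
    ((integrable_sigma_sq_mul_samplingDensity hJ hG y hv).const_mul _)
  simp only [integral_const_mul] at h
  exact h

lemma integral_inv_sqrt_mul_rpow_mul_mixtureDensity (hJ : 3 < J) (hG : ∀ᵐ p ∂G, 0 < p.2) (y : ℝ)
    {v : ℝ} (hv : 0 < v) :
    IntegrableOn (fun t => 1 / √(shapeK J * (t - v)) * (v / t) ^ (shapeK J - 1) *
      mixtureDensity J G y t) (Ioi v) ∧
    ∫ t in Ioi v, 1 / √(shapeK J * (t - v)) * (v / t) ^ (shapeK J - 1) * mixtureDensity J G y t =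
      Real.Gamma (1 / 2) / shapeK J * ∫ p, p.2 * samplingDensity J p.1 p.2 y v ∂G := by
  have hk := shapeK_pos (by omega : 1 < J)
  have e : ∀ t m s : ℝ, 1 / √(shapeK J * (t - v)) * (v / t) ^ (shapeK J - 1) *
      samplingDensity J m s y t =
      gaussianPDFReal m (s ^ 2 / J).toNNReal y *
        (1 / √(shapeK J * (t - v)) * (v / t) ^ (shapeK J - 1) *
          gammaPDFReal (shapeK J) (shapeK J / s ^ 2) t) := fun t m s => by
    rw [samplingDensity]; ring
  have h := integrable_integral_of_nonneg (ρ := G) (ν := volume.restrict (Ioi v))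
    (F := fun t p => 1 / √(shapeK J * (t - v)) * (v / t) ^ (shapeK J - 1) *
      samplingDensity J p.1 p.2 y t)
    (W := fun p => Real.Gamma (1 / 2) / shapeK J * (p.2 * samplingDensity J p.1 p.2 y v))
    (by fun_prop)
    (by
      filter_upwards [hG] with p hp
      filter_upwards [ae_restrict_mem measurableSet_Ioi] with t ht
      have ht0 : 0 < t := hv.trans ht
      exact mul_nonneg (by positivity) (samplingDensity_nonneg (by omega) hp y t))
    (by
      filter_upwards [hG] with p hp
      simp only [e]
      exact (integrableOn_inv_sqrt_mul_rpow_mul_gammaPDFReal hk.le (by positivity) hv).const_mul _)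
    (by
      filter_upwards [hG] with p hp
      simp only [e]
      rw [integral_const_mul,
        integral_inv_sqrt_mul_rpow_mul_gammaPDFReal hk.le (by positivity) hv, samplingDensity,
        one_div_div, ← Real.sqrt_eq_rpow, Real.sqrt_div (by positivity), Real.sqrt_sq hp.le]
      have hks : √(shapeK J) ≠ 0 := (Real.sqrt_pos.2 hk).ne'
      have hks2 : √(shapeK J) ^ 2 = shapeK J := Real.sq_sqrt hk.le
      field_simp
      rw [hks2]
      field_simp)
    ((integrable_sigma_mul_samplingDensity (by omega) hG y hv).const_mul _)
  simp only [integral_const_mul] at h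
  exact h

lemma integrable_posteriorLaw (hJ : 1 < J) (hG : ∀ᵐ p ∂G, 0 < p.2) {y v : ℝ} (hv : 0 < v)
    (hsd : Integrable (fun p : ℝ × ℝ => samplingDensity J p.1 p.2 y v) G) {h : ℝ × ℝ → ℝ}
    (hint : Integrable (fun p : ℝ × ℝ => h p * samplingDensity J p.1 p.2 y v) G) :
    Integrable h (posteriorLaw J G y v) := by
  refine Integrable.smul_measure ?_ (by simpa using mixtureDensity_pos hJ hG hv hsd)
  rw [integrable_withDensity_iff_integrable_smul' (by fun_prop)
    (ae_of_all _ fun _ => ENNReal.ofReal_lt_top)]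
  refine hint.congr ?_
  filter_upwards [hG] with p hp
  rw [ENNReal.toReal_ofReal (samplingDensity_nonneg hJ hp y v), smul_eq_mul, mul_comm]

lemma integral_mixtureDensity_mean_pos (hJ : 3 < J) (hG : ∀ᵐ p ∂G, 0 < p.2) {v : ℝ} (hv : 0 < v) :
    0 < ∫ x, mixtureDensity J G x v := by
  rw [integral_pos_iff_support_of_nonneg (fun x => mixtureDensity_nonneg (by omega) hG x v)
    (integrable_mixtureDensity_mean hJ hG hv)]
  have : Function.support (fun x => mixtureDensity J G x v) = univ := eq_univ_of_forall fun x =>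
    (mixtureDensity_pos (by omega) hG hv (integrable_samplingDensity hJ hG x v)).ne'
  simp [this]

lemma integral_mixtureDensity_var_pos (hJ : 3 < J) (hG : ∀ᵐ p ∂G, 0 < p.2) {y : ℝ}
    (hint : Integrable fun t => mixtureDensity J G y t) :
    0 < ∫ t, mixtureDensity J G y t := by
  rw [integral_pos_iff_support_of_nonneg (fun t => mixtureDensity_nonneg (by omega) hG y t) hint]
  have : Ioi 0 ⊆ Function.support (fun t => mixtureDensity J G y t) := fun t ht =>
    (mixtureDensity_pos (by omega) hG ht (integrable_samplingDensity hJ hG y t)).ne'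
  refine lt_of_lt_of_le ?_ (measure_mono this)
  simp

lemma posteriorMean_sigma_sq (hJ : 3 < J) (hG : ∀ᵐ p ∂G, 0 < p.2) (y : ℝ) {v : ℝ} (hv : 0 < v) :
    posteriorMean J G (fun p => p.2 ^ 2) y v =
      shapeK J * ∫ t in Ioi v, (v / t) ^ (shapeK J - 1) *
        (mixtureDensity J G y t / mixtureDensity J G y v) := by
  have hk := shapeK_pos (by omega : 1 < J)
  rw [posteriorMean_eq (by omega) hG]
  simp only [← mul_div_assoc]
  rw [integral_div, (integral_rpow_mul_mixtureDensity hJ hG y hv).2]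
  field_simp

lemma posteriorMean_sigma (hJ : 3 < J) (hG : ∀ᵐ p ∂G, 0 < p.2) (y : ℝ) {v : ℝ} (hv : 0 < v) :
    posteriorMean J G (fun p => p.2) y v =
      shapeK J / Real.Gamma (1 / 2) *
        ∫ t in Ioi v, 1 / √(shapeK J * (t - v)) * (v / t) ^ (shapeK J - 1) *
          (mixtureDensity J G y t / mixtureDensity J G y v) := by
  have hk := shapeK_pos (by omega : 1 < J)
  have hΓ := Real.Gamma_pos_of_pos one_half_pos
  rw [posteriorMean_eq (by omega) hG]
  simp only [← mul_div_assoc]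
  rw [integral_div, (integral_inv_sqrt_mul_rpow_mul_mixtureDensity hJ hG y hv).2]
  field_simp

lemma condDensityVar_div_condDensityVar (hJ : 3 < J) (hG : ∀ᵐ p ∂G, 0 < p.2) {y : ℝ}
    (hint : Integrable fun t => mixtureDensity J G y t) (t v : ℝ) :
    condDensityVar J G t y / condDensityVar J G v y =
      mixtureDensity J G y t / mixtureDensity J G y v :=
  div_div_div_cancel_right₀ (integral_mixtureDensity_var_pos hJ hG hint).ne' _ _

/-- The marginal in the denominator is constant in `x`, so it drops out of the logarithmic
derivative. -/
lemma hasDerivAt_log_condDensityMean (hJ : 3 < J) (hG : ∀ᵐ p ∂G, 0 < p.2) (y : ℝ) {v : ℝ}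
    (hv : 0 < v) :
    HasDerivAt (fun x => Real.log (condDensityMean J G x v))
      (deriv (fun x => mixtureDensity J G x v) y / mixtureDensity J G y v) y := by
  have hI := integral_mixtureDensity_mean_pos hJ hG hv
  have hf := mixtureDensity_pos (J := J) (by omega) hG hv (integrable_samplingDensity hJ hG y v)
  have h := ((differentiableAt_mixtureDensity hJ hG hv y).hasDerivAt.div_const
    (∫ x, mixtureDensity J G x v)).log (div_pos hf hI).ne'
  refine h.congr_deriv ?_
  field_simp

lemma hasDerivAt_posteriorMean_sigma_sq (hJ : 3 < J) (hG : ∀ᵐ p ∂G, 0 < p.2) (y : ℝ) {v : ℝ}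
    (hv : 0 < v) :
    HasDerivAt (fun x => posteriorMean J G (fun p => p.2 ^ 2) x v)
      (J * (posteriorMean J G (fun p => p.1) y v - y) -
        posteriorMean J G (fun p => p.2 ^ 2) y v *
          (deriv (fun x => mixtureDensity J G x v) y / mixtureDensity J G y v)) y := by
  have hJ1 : 1 < J := by omega
  have hf := (mixtureDensity_pos hJ1 hG hv (integrable_samplingDensity hJ hG y v)).ne'
  have h := (hasDerivAt_integral_sigma_sq_mul_samplingDensity hJ hG hv y).div
    (differentiableAt_mixtureDensity hJ hG hv y).hasDerivAt hf
  simp only [posteriorMean_eq hJ1 hG]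
  refine h.congr_deriv ?_
  field_simp

end Mixture

/-! ### The main theorem. -/

theorem theorem1 {Ω : Type*} [MeasurableSpace Ω] (P : Measure Ω) [IsProbabilityMeasure P]
    (J : ℕ) (hJ : 3 < J) (G : Measure (ℝ × ℝ)) [IsProbabilityMeasure G]
    (hG : ∀ᵐ p ∂G, 0 < p.2)
    (mu sigma : Ω → ℝ) (eps Y : Fin J → Ω → ℝ)
    (hmodel : IsHeteroskedasticModel P G mu sigma eps Y) :
    -- the mixture density is the density of the statistics (sample mean, sample variance)
    HasLaw (fun ω => (sampleMean fun j => Y j ω, sampleVar fun j => Y j ω))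
      ((volume : Measure (ℝ × ℝ)).withDensity
        fun q => ENNReal.ofReal (mixtureDensity J G q.1 q.2)) P ∧
    -- the Bayes posterior is the conditional law of the parameters given these statistics
    (∀ᵐ q ∂(P.map fun ω => (sampleMean fun j => Y j ω, sampleVar fun j => Y j ω)),
      condDistrib (fun ω => (mu ω, sigma ω))
        (fun ω => (sampleMean fun j => Y j ω, sampleVar fun j => Y j ω)) P q
        = posteriorLaw J G q.1 q.2) ∧
    -- the marginal density of the sample mean is finite almost everywhere
    (∀ᵐ y : ℝ, Integrable fun t => mixtureDensity J G y t) ∧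
    ∀ y s : ℝ, 0 < s →
      -- all objects in the formulae are well defined
      (0 < mixtureDensity J G y (s ^ 2) ∧
        (Integrable fun x => mixtureDensity J G x (s ^ 2)) ∧
        IsProbabilityMeasure (posteriorLaw J G y (s ^ 2)) ∧
        Integrable (fun p : ℝ × ℝ => p.1) (posteriorLaw J G y (s ^ 2)) ∧
        Integrable (fun p : ℝ × ℝ => p.2 ^ 2) (posteriorLaw J G y (s ^ 2)) ∧
        Integrable (fun p : ℝ × ℝ => p.2) (posteriorLaw J G y (s ^ 2)) ∧
        DifferentiableAt ℝ (fun x => Real.log (condDensityMean J G x (s ^ 2))) y ∧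
        DifferentiableAt ℝ (fun x => posteriorMean J G (fun p => p.2 ^ 2) x (s ^ 2)) y ∧
        IntegrableOn (fun t => (s ^ 2 / t) ^ (shapeK J - 1) *
          (mixtureDensity J G y t / mixtureDensity J G y (s ^ 2))) (Ioi (s ^ 2)) ∧
        IntegrableOn (fun t => 1 / √(shapeK J * (t - s ^ 2)) * (s ^ 2 / t) ^ (shapeK J - 1) *
          (mixtureDensity J G y t / mixtureDensity J G y (s ^ 2))) (Ioi (s ^ 2))) ∧
      -- (i)
      posteriorMean J G (fun p => p.1) y (s ^ 2) =
        y + posteriorMean J G (fun p => p.2 ^ 2) y (s ^ 2) / J *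
              deriv (fun x => Real.log (condDensityMean J G x (s ^ 2))) y
          + 1 / J * deriv (fun x => posteriorMean J G (fun p => p.2 ^ 2) x (s ^ 2)) y ∧
      -- (ii)
      posteriorMean J G (fun p => p.2 ^ 2) y (s ^ 2) =
        shapeK J * ∫ t in Ioi (s ^ 2), (s ^ 2 / t) ^ (shapeK J - 1) *
          (mixtureDensity J G y t / mixtureDensity J G y (s ^ 2)) ∧
      -- (iii)
      posteriorMean J G (fun p => p.2) y (s ^ 2) =
        shapeK J / Real.Gamma (1 / 2) *
          ∫ t in Ioi (s ^ 2), 1 / √(shapeK J * (t - s ^ 2)) * (s ^ 2 / t) ^ (shapeK J - 1) *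
            (mixtureDensity J G y t / mixtureDensity J G y (s ^ 2)) ∧
      -- (ii) and (iii) in terms of the conditional density of the sample variance
      ((Integrable fun t => mixtureDensity J G y t) →
        posteriorMean J G (fun p => p.2 ^ 2) y (s ^ 2) =
          shapeK J * ∫ t in Ioi (s ^ 2), (s ^ 2 / t) ^ (shapeK J - 1) *
            (condDensityVar J G t y / condDensityVar J G (s ^ 2) y) ∧
        posteriorMean J G (fun p => p.2) y (s ^ 2) =
          shapeK J / Real.Gamma (1 / 2) *
            ∫ t in Ioi (s ^ 2), 1 / √(shapeK J * (t - s ^ 2)) * (s ^ 2 / t) ^ (shapeK J - 1) *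
              (condDensityVar J G t y / condDensityVar J G (s ^ 2) y)) := by
  have hint := integrable_samplingDensity hJ hG
  have hJ1 : 1 < J := by omega
  have hJ0 : (0 : ℝ) < J := by positivity
  refine ⟨hmodel.hasLaw_stat hJ hG hint, hmodel.condDistrib_param_ae_eq hJ hG hint,
    Integrable.prod_right_ae (integrable_mixtureDensity_prod hJ hG hint), fun y s hs => ?_⟩
  have hv : 0 < s ^ 2 := by positivity
  have hlog := hasDerivAt_log_condDensityMean hJ hG y hv
  have hpost := hasDerivAt_posteriorMean_sigma_sq hJ hG y hv
  refine ⟨⟨mixtureDensity_pos hJ1 hG hv (hint y _), integrable_mixtureDensity_mean hJ hG hv,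
    isProbabilityMeasure_posteriorLaw hJ1 hG hv (hint y _),
    integrable_posteriorLaw hJ1 hG hv (hint y _) (integrable_mu_mul_samplingDensity hJ hG y hv),
    integrable_posteriorLaw hJ1 hG hv (hint y _)
      (integrable_sigma_sq_mul_samplingDensity hJ hG y hv),
    integrable_posteriorLaw hJ1 hG hv (hint y _) (integrable_sigma_mul_samplingDensity hJ1 hG y hv),
    hlog.differentiableAt, hpost.differentiableAt, ?_, ?_⟩, ?_, posteriorMean_sigma_sq hJ hG y hv,
    posteriorMean_sigma hJ hG y hv, fun hy => ?_⟩
  · simp only [← mul_div_assoc]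
    exact (integral_rpow_mul_mixtureDensity hJ hG y hv).1.div_const _
  · simp only [← mul_div_assoc]
    exact (integral_inv_sqrt_mul_rpow_mul_mixtureDensity hJ hG y hv).1.div_const _
  -- The score terms cancel, leaving $J^{-1}\cdot J(\mathbb{E}[\mu\mid y,s]-y)$.
  · rw [hlog.deriv, hpost.deriv]
    field_simp
    ring
  · simp only [condDensityVar_div_condDensityVar hJ hG hy]
    exact ⟨posteriorMean_sigma_sq hJ hG y hv, posteriorMean_sigma hJ hG y hv⟩
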